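/- Let $n\ge 1$. For $\pi\in S_n$ let the descent set of $\pi$ be the set of all $i\in\{1,\dots,n-1\}$ with $\pi(i)>\pi(i+1)$, together with $n$ (by convention every permutation has a descent at position $n$). For a set $K=\{k_1<k_2<\cdots<k_d=n\}\subseteq\{1,\dots,n\}$ containing $n$, put $k_0=0$ and let $C(K)=(k_1-k_0,\dots,k_d-k_{d-1})$ be its composition. For non-negative integers $r_1,\dots,r_a$ with sum $n$ put \[ M(r_1,\dots,r_a)=\frac1n\sum_{d\mid n,r_1,\dots,r_a}\mu(d)\,\frac{(n/d)!}{(r_1/d)!\cdots(r_a/d)!}, \] where $d$ runs over the positive common divisors and $\mu$ is the Möbius function. Then for every $J\subseteq\{1,\dots,n\}$ with $n\in J$, the number of $n$-cycles in $S_n$ with descent set $J$ is \[ \sum_{K\subseteq J,\ n\in K}(-1)^{|J|-|K|}\,M(C(K)). \] -/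

import Mathlib

/-- The descent set of `π ∈ S_n`, as a set of positions in `{1, …, n}`: position `n` is by
convention always a descent, and `k < n` is a descent if `π(k) > π(k+1)`. The index `i : Fin n`
stands for the position `i + 1`. -/
def descentSet {n : ℕ} (π : Equiv.Perm (Fin n)) : Finset ℕ :=
  {k ∈ Finset.Icc 1 n | k = n ∨
    ∃ i j : Fin n, i.val + 1 = k ∧ j.val + 1 = k + 1 ∧ π j < π i}

/-- The composition `C(K) = (k₁ - k₀, k₂ - k₁, …, k_d - k_{d-1})` of a finite set
`K = {k₁ < ⋯ < k_d}` of positive integers, where `k₀ = 0`. -/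
def compositionOf (K : Finset ℕ) : List ℕ :=
  List.zipWith (fun b a => b - a) (K.sort (· ≤ ·)) (0 :: K.sort (· ≤ ·))

/-- `M(r₁, …, r_a) = (1/n) ∑_{d ∣ n, r₁, …, r_a} μ(d) (n/d)! / ((r₁/d)! ⋯ (r_a/d)!)`,
where `n = r₁ + ⋯ + r_a`. -/
def necklaceM (r : List ℕ) : ℚ :=
  (1 / (r.sum : ℚ)) * ∑ d ∈ r.sum.divisors with ∀ x ∈ r, d ∣ x,
    (ArithmeticFunction.moebius d : ℚ) *
      (((r.sum / d).factorial : ℚ) / ((r.map fun x => (x / d).factorial).prod : ℚ))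

/-- `π ∈ S_n` is an `n`-cycle: all `n` points lie on a single cycle of `π`
(for `n = 1` the identity counts). -/
def IsNCycle {n : ℕ} (π : Equiv.Perm (Fin n)) : Prop :=
  π.IsCycleOn Set.univ

/-! By inclusion-exclusion over `K`, it suffices to show that `M(C(K))` counts the `n`-cycles with
descents inside `K`, that is, those increasing on the blocks cut out by `K`. Choosing a starting
point multiplies this count by `n` and turns a cycle into a listing `φ : ZMod n ≃ Fin n`. Replacing
each entry by its block gives a word `c ∘ φ` on `ℤ/n` whose letter multiplicities are the block
sizes. Since the cycle preserves order inside blocks, two entries compare as the periodic words read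
from them do lexicographically (`readFrom_lt_of_lt`). So the word is primitive and determines `φ`;
conversely, sorting the rotations of a primitive word recovers a listing
(`IsPrimitiveWord.exists_comp_eq`). Primitive words are counted by Möbius inversion over periods
(`card_primitive_words`). -/

/-! ### Multinomial counts -/

open Finset in
/-- Two maps with equal fiber sizes differ by a permutation of the domain. -/
theorem exists_perm_comp_eq_of_card_fiber_eq {α β ι : Type*} [Fintype α] [Fintype β]
    [DecidableEq ι] {f : α → ι} {g : β → ι}
    (h : ∀ i, #{a | f a = i} = #{b | g b = i}) : ∃ e : α ≃ β, g ∘ e = f := by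
  have H : ∀ i, Nonempty ({a // f a = i} ≃ {b // g b = i}) := fun i =>
    Fintype.card_eq.1 (by simpa [Fintype.card_subtype] using h i)
  refine ⟨Equiv.ofFiberEquiv fun i => (H i).some, ?_⟩
  ext a
  exact Equiv.ofFiberEquiv_map _ a

open Finset in
theorem exists_card_fiber_eq {α ι : Type*} [Fintype α] [Fintype ι] [DecidableEq ι] (r : ι → ℕ)
    (hr : ∑ i, r i = Fintype.card α) : ∃ f : α → ι, ∀ i, #{a | f a = i} = r i := by
  have e : α ≃ Σ i, Fin (r i) := Fintype.equivOfCardEq (by simp [hr])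
  refine ⟨fun a => (e a).1, fun i => ?_⟩
  have h := Fintype.card_congr ((e.subtypeEquiv (p := fun a => (e a).1 = i)
    (q := fun b => b.1 = i) fun _ => Iff.rfl).trans (Equiv.sigmaSubtype i))
  simpa [Fintype.card_subtype] using h

open Finset in
/-- The number of maps with prescribed fiber sizes is a multinomial coefficient. -/
theorem card_maps_with_card_fiber_mul_prod_factorial {α ι : Type*} [Fintype α] [DecidableEq α]
    [Fintype ι] [DecidableEq ι] (r : ι → ℕ) (hr : ∑ i, r i = Fintype.card α) :
    #{f : α → ι | ∀ i, #{a | f a = i} = r i} * ∏ i, (r i).factorial =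
      (Fintype.card α).factorial := by
  obtain ⟨f₀, hf₀⟩ := exists_card_fiber_eq r hr
  -- Permutations `g` are grouped by `f₀ ∘ g`; each class is a coset of the stabilizer of `f₀`, of
  -- order `∏ i, (r i)!`.
  rw [← Fintype.card_perm, ← Finset.card_univ (α := Equiv.Perm α),
    Finset.card_eq_sum_card_fiberwise (f := fun g : Equiv.Perm α => f₀ ∘ g)
      (t := {f : α → ι | ∀ i, #{a | f a = i} = r i}), ← smul_eq_mul, ← Finset.sum_const]
  · refine Finset.sum_congr rfl fun f hf => ?_
    obtain ⟨e, he⟩ := exists_perm_comp_eq_of_card_fiber_eq (f := f) (g := f₀)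
      fun i => by rw [hf₀, (Finset.mem_filter.1 hf).2]
    have hs := DomMulAct.stabilizer_card f₀
    simp only [Fintype.card_subtype, hf₀] at hs
    rw [← hs, eq_comm]
    refine Finset.card_equiv (Equiv.mulRight e⁻¹) fun g => ?_
    simp only [mem_filter, mem_univ, true_and, Equiv.coe_mulRight, Equiv.Perm.coe_mul, ← he]
    constructor
    · intro h
      rw [← Function.comp_assoc, h]
      ext a
      simp
    · intro h
      ext a
      simpa using congrFun h (e a)
  · intro g _
    simp only [coe_filter, mem_univ, true_and, Set.mem_ofPred_eq]
    intro i
    rw [← hf₀ i]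
    exact Finset.card_equiv g (by simp)

/-! ### Periodic and primitive words on `ℤ/n` -/

open Finset in
/-- Every fiber of the reduction `ℤ/dm → ℤ/m` has `d` elements. -/
theorem ZMod.card_fiber_castHom {n m d : ℕ} [NeZero n] [NeZero m] (hn : n = d * m) (s : ZMod m) :
    #{t : ZMod n | ZMod.castHom (hn ▸ dvd_mul_left m d) (ZMod m) t = s} = d := by
  have hdvd : m ∣ n := hn ▸ dvd_mul_left m d
  have hsurj := ZMod.castHom_surjective hdvd
  have h := Finset.card_eq_sum_card_fiberwise (f := ZMod.castHom hdvd (ZMod m))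
    (s := univ) (t := univ) (by simp [Set.MapsTo])
  rw [Finset.sum_congr rfl fun b _ => AddMonoidHom.card_fiber_eq_of_mem_range
    (ZMod.castHom hdvd (ZMod m)) (hsurj b) (hsurj s)] at h
  simp only [card_univ, ZMod.card, sum_const, smul_eq_mul] at h
  have hm : 0 < m := Nat.pos_of_neZero m
  refine Nat.eq_of_mul_eq_mul_left hm ?_
  rw [← h, hn, mul_comm]

open Finset in
theorem card_fiber_comp_castHom {ι : Type*} [DecidableEq ι] {n m d : ℕ} [NeZero n] [NeZero m]
    (hn : n = d * m) (v : ZMod m → ι) (i : ι) :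
    #{t : ZMod n | v (ZMod.castHom (hn ▸ dvd_mul_left m d) (ZMod m) t) = i} =
      d * #{s | v s = i} := by
  rw [Finset.card_eq_sum_card_fiberwise
    (f := ZMod.castHom (hn ▸ dvd_mul_left m d : m ∣ n) (ZMod m)) (t := {s | v s = i})
    (fun t ht => by
      simp only [coe_filter, mem_univ, true_and, Set.mem_ofPred_eq] at ht ⊢; exact ht)]
  rw [Finset.sum_congr rfl (g := fun _ => d), Finset.sum_const, smul_eq_mul, mul_comm]
  intro s hs
  refine Eq.trans (congrArg Finset.card ?_) (ZMod.card_fiber_castHom hn s)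
  ext t
  simp only [mem_filter, mem_univ, true_and] at hs ⊢
  constructor
  · exact fun h => h.2
  · rintro rfl
    exact ⟨hs, rfl⟩

/-- A word on `ℤ/n` of period `m ∣ n` descends to `ℤ/m`. -/
theorem exists_comp_castHom_eq_of_periodic {ι : Type*} {n m : ℕ} [NeZero n] [NeZero m]
    (hdvd : m ∣ n) {w : ZMod n → ι} (hw : ∀ t, w (t + m) = w t) :
    ∃ v : ZMod m → ι, v ∘ ZMod.castHom hdvd (ZMod m) = w := by
  have hk : ∀ (k : ℕ) t, w (t + (m * k : ℕ)) = w t := by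
    intro k
    induction k with
    | zero => simp
    | succ k ih =>
      intro t
      rw [mul_add, mul_one, Nat.cast_add, ← add_assoc, hw, ih]
  refine ⟨fun s => w (s.val : ZMod n), ?_⟩
  ext t
  have h1 : (ZMod.castHom hdvd (ZMod m) t).val = t.val % m := by
    rw [ZMod.castHom_apply, ZMod.cast_eq_val, ZMod.val_natCast]
  simp only [Function.comp_apply]
  rw [h1]
  conv_rhs => rw [← ZMod.natCast_zmod_val t, ← Nat.mod_add_div t.val m, Nat.cast_add, hk]

open Finset in
/-- The number of words on `ℤ/n` with prescribed letter multiplicities and period `n / d`. -/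
theorem card_periodic_words {ι : Type*} [Fintype ι] [DecidableEq ι] {n d : ℕ} [NeZero n]
    (hd : d ∣ n) (r : ι → ℕ) (hr : ∑ i, r i = n) :
    (#{w : ZMod n → ι | (∀ i, #{t | w t = i} = r i) ∧ ∀ t, w (t + (n / d : ℕ)) = w t} : ℚ) =
      if ∀ i, d ∣ r i then
        ((n / d).factorial : ℚ) / ∏ i, ((r i / d).factorial : ℚ) else 0 := by
  obtain ⟨m, hn⟩ := hd
  have hn0 : 0 < n := Nat.pos_of_neZero n
  have hd0 : 0 < d := Nat.pos_of_ne_zero (by rintro rfl; simp at hn; omega)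
  have hm0 : 0 < m := Nat.pos_of_ne_zero (by rintro rfl; simp at hn; omega)
  have : NeZero m := ⟨hm0.ne'⟩
  have hdvd : m ∣ n := hn ▸ dvd_mul_left m d
  have hnd : n / d = m := by rw [hn, Nat.mul_div_cancel_left _ hd0]
  rw [hnd]
  split_ifs with h
  · choose q hq using h
    have hq' : ∀ i, r i / d = q i := fun i => by rw [hq, Nat.mul_div_cancel_left _ hd0]
    have hsum : ∑ i, q i = Fintype.card (ZMod m) := by
      rw [ZMod.card]
      refine Nat.eq_of_mul_eq_mul_left hd0 ?_
      rw [Finset.mul_sum, ← hn, ← hr]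
      exact Finset.sum_congr rfl fun i _ => (hq i).symm
    simp only [hq']
    have key := card_maps_with_card_fiber_mul_prod_factorial q hsum
    rw [ZMod.card] at key
    rw [eq_div_iff (by exact_mod_cast Finset.prod_ne_zero_iff.2 fun i _ => Nat.factorial_ne_zero _)]
    rw [← key]
    push_cast
    congr 2
    symm
    refine Finset.card_bij (fun v _ => v ∘ ZMod.castHom hdvd (ZMod m)) ?_ ?_ ?_
    · intro v hv
      simp only [mem_filter, mem_univ, true_and] at hv ⊢
      refine ⟨fun i => ?_, fun t => ?_⟩
      · rw [hq, ← hv i]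
        exact card_fiber_comp_castHom hn v i
      · rw [Function.comp_apply, map_add, map_natCast, ZMod.natCast_self, add_zero,
          Function.comp_apply]
    · intro v _ v' _ h
      exact (ZMod.castHom_surjective hdvd).injective_comp_right h
    · intro w hw
      simp only [mem_filter, mem_univ, true_and] at hw
      obtain ⟨v, rfl⟩ := exists_comp_castHom_eq_of_periodic hdvd hw.2
      refine ⟨v, ?_, rfl⟩
      simp only [mem_filter, mem_univ, true_and]
      intro i
      refine Nat.eq_of_mul_eq_mul_left hd0 ?_
      rw [← hq, ← hw.1 i]
      exact (card_fiber_comp_castHom hn v i).symm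
  · rw [Nat.cast_eq_zero, Finset.card_eq_zero, Finset.filter_eq_empty_iff]
    rintro w - ⟨hw, hp⟩
    obtain ⟨v, rfl⟩ := exists_comp_castHom_eq_of_periodic hdvd hp
    exact h fun i => by
      rw [← hw i]
      exact Dvd.intro _ (card_fiber_comp_castHom hn v i).symm

/-- A word on `ℤ/n` is primitive if its `n` rotations are distinct. -/
def IsPrimitiveWord {ι : Type*} {n : ℕ} (w : ZMod n → ι) : Prop :=
  ∀ t, (∀ s, w (s + t) = w s) → t = 0

open ArithmeticFunction in
theorem sum_divisors_moebius_eq_ite (n : ℕ) :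
    ∑ d ∈ n.divisors, (moebius d : ℚ) = if n = 1 then 1 else 0 := by
  have h := congrArg (fun f : ArithmeticFunction ℤ => f n) moebius_mul_coe_zeta
  simp only [coe_mul_zeta_apply, one_apply] at h
  exact_mod_cast h

open Classical in
/-- The Möbius sum over the periods of a word detects primitivity. -/
theorem sum_moebius_periodic {ι : Type*} {n : ℕ} [NeZero n] (w : ZMod n → ι) :
    (∑ d ∈ n.divisors with ∀ t, w (t + (n / d : ℕ)) = w t,
      (ArithmeticFunction.moebius d : ℚ)) = if IsPrimitiveWord w then 1 else 0 := by
  have hn0 : n ≠ 0 := NeZero.ne n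
  let rot : (ZMod n → ι) → ZMod n → ι := fun w t => w (t + 1)
  have hrot : ∀ (k : ℕ) (u : ZMod n → ι), rot^[k] u = fun t => u (t + k) := by
    intro k
    induction k with
    | zero => intro u; simp
    | succ k ih =>
      intro u
      rw [Function.iterate_succ_apply, ih]
      ext t
      simp [rot, add_assoc]
  have hper : ∀ k : ℕ, (∀ t, w (t + k) = w t) ↔ Function.minimalPeriod rot w ∣ k := by
    intro k
    rw [← Function.isPeriodicPt_iff_minimalPeriod_dvd, Function.IsPeriodicPt,
      Function.IsFixedPt, hrot, funext_iff]
  set p := Function.minimalPeriod rot w with hp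
  have hpn : p ∣ n := (hper n).1 (by simp)
  obtain ⟨q, hq⟩ := hpn
  have hp0 : p ≠ 0 := by rintro h; rw [h] at hq; omega
  have hq0 : q ≠ 0 := by rintro rfl; omega
  -- With `n = p * q` and `p` the least period, `n / d` is a period exactly when `d ∣ q`;
  -- primitivity is the case `q = 1`.
  have hset : {d ∈ n.divisors | ∀ t, w (t + (n / d : ℕ)) = w t} = q.divisors := by
    ext d
    simp only [Finset.mem_filter, Nat.mem_divisors, hper]
    constructor
    · rintro ⟨⟨hd, -⟩, hd'⟩
      refine ⟨?_, hq0⟩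
      obtain ⟨m, hm⟩ := hd
      have hd0 : 0 < d := Nat.pos_of_ne_zero (by rintro rfl; simp at hm; omega)
      rw [hm, Nat.mul_div_cancel_left _ hd0] at hd'
      obtain ⟨e, rfl⟩ := hd'
      refine ⟨e, Nat.eq_of_mul_eq_mul_left (Nat.pos_of_ne_zero hp0) ?_⟩
      rw [← hq, hm]; ring
    · rintro ⟨⟨e, rfl⟩, -⟩
      have hd0 : 0 < d := Nat.pos_of_ne_zero (by rintro rfl; simp at hq0)
      have : n = d * (p * e) := by rw [hq]; ring
      refine ⟨⟨⟨_, this⟩, hn0⟩, ?_⟩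
      rw [this, Nat.mul_div_cancel_left _ hd0]
      exact dvd_mul_right _ _
  rw [hset, sum_divisors_moebius_eq_ite]
  congr 1
  rw [eq_iff_iff]
  constructor
  · rintro rfl t ht
    rw [← ZMod.natCast_zmod_val t] at ht ⊢
    have := (hper _).1 ht
    rw [ZMod.natCast_eq_zero_iff]
    exact (dvd_of_eq (hq.trans (mul_one p))).trans this
  · intro h
    have := h p ((hper p).2 dvd_rfl)
    rw [ZMod.natCast_eq_zero_iff] at this
    have h2 : p * q ∣ p * 1 := by rw [mul_one, ← hq]; exact this
    exact Nat.dvd_one.1 (Nat.dvd_of_mul_dvd_mul_left (Nat.pos_of_ne_zero hp0) h2)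

open Finset Classical in
/-- The number of primitive words with prescribed letter multiplicities. -/
theorem card_primitive_words {ι : Type*} [Fintype ι] {n : ℕ} [NeZero n]
    (r : ι → ℕ) (hr : ∑ i, r i = n) :
    (#{w : ZMod n → ι | (∀ i, #{t | w t = i} = r i) ∧ IsPrimitiveWord w} : ℚ) =
      ∑ d ∈ n.divisors with ∀ i, d ∣ r i, (ArithmeticFunction.moebius d : ℚ) *
        (((n / d).factorial : ℚ) / ∏ i, ((r i / d).factorial : ℚ)) := by
  rw [← Finset.filter_filter, Finset.natCast_card_filter]
  simp_rw [← sum_moebius_periodic]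
  simp_rw [Finset.sum_filter (s := n.divisors)]
  rw [Finset.sum_comm]
  refine Finset.sum_congr rfl fun d hd => ?_
  rw [← Finset.sum_filter, Finset.sum_const, Finset.filter_filter, nsmul_eq_mul,
    card_periodic_words (Nat.dvd_of_mem_divisors hd) r hr]
  split_ifs <;> ring

/-! ### Cycles and primitive words -/

/-- `π` is strictly increasing on the fibers of `c`. -/
def StrictMonoOnFibers {n : ℕ} {ι : Type*} (c : Fin n → ι) (π : Equiv.Perm (Fin n)) : Prop :=
  ∀ ⦃x y⦄, x < y → c x = c y → π x < π y

/-- The infinite periodic word read off a word on `ℤ/n` from position `s` on. -/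
def readFrom {n : ℕ} {ι : Type*} (w : ZMod n → ι) (s : ZMod n) : Lex (ℕ → ι) :=
  toLex fun k => w (s + k)

theorem readFrom_apply {n : ℕ} {ι : Type*} (w : ZMod n → ι) (s : ZMod n) (k : ℕ) :
    readFrom w s k = w (s + k) := rfl

theorem IsPrimitiveWord.readFrom_injective {n : ℕ} [NeZero n] {ι : Type*} {w : ZMod n → ι}
    (hw : IsPrimitiveWord w) : Function.Injective (readFrom w) := by
  intro s t h
  refine (sub_eq_zero.1 (hw (t - s) fun u => ?_)).symm
  have := congrFun h (u - s).val
  simp only [readFrom_apply, ZMod.natCast_zmod_val] at this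
  rw [show u + (t - s) = t + (u - s) by ring, ← this]
  congr 1
  ring

/-- The rotation permutation attached to a cyclic listing `φ` of `Fin n`. -/
def cyclePerm {n : ℕ} (φ : ZMod n ≃ Fin n) : Equiv.Perm (Fin n) :=
  (φ.symm.trans (Equiv.addRight 1)).trans φ

theorem cyclePerm_apply {n : ℕ} (φ : ZMod n ≃ Fin n) (t : ZMod n) :
    cyclePerm φ (φ t) = φ (t + 1) := by
  simp [cyclePerm]

theorem cyclePerm_pow_apply {n : ℕ} (φ : ZMod n ≃ Fin n) (k : ℕ) (t : ZMod n) :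
    (cyclePerm φ ^ k) (φ t) = φ (t + k) := by
  induction k with
  | zero => simp
  | succ k ih => rw [pow_succ', Equiv.Perm.mul_apply, ih, cyclePerm_apply, Nat.cast_succ, add_assoc]

theorem isNCycle_cyclePerm {n : ℕ} [NeZero n] (φ : ZMod n ≃ Fin n) : IsNCycle (cyclePerm φ) := by
  refine ⟨Set.bijOn_univ.2 (Equiv.bijective _), fun x _ y _ => ?_⟩
  refine ⟨((φ.symm y - φ.symm x).val : ℕ), ?_⟩
  rw [zpow_natCast]
  conv_lhs => rw [← φ.apply_symm_apply x]
  rw [cyclePerm_pow_apply, ZMod.natCast_zmod_val]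
  simp

theorem IsNCycle.exists_cyclePerm_eq {n : ℕ} [NeZero n] {π : Equiv.Perm (Fin n)}
    (hπ : IsNCycle π) (x : Fin n) : ∃ φ : ZMod n ≃ Fin n, cyclePerm φ = π ∧ φ 0 = x := by
  have hc : π.IsCycleOn ((Finset.univ : Finset (Fin n)) : Set (Fin n)) := by
    simpa [IsNCycle] using hπ
  have hpow : ∀ {k l : ℕ}, (π ^ k) x = (π ^ l) x ↔ k ≡ l [MOD n] := by
    intro k l
    simpa using hc.pow_apply_eq_pow_apply (Finset.mem_univ x) (m := k) (n := l)
  have hinj : Function.Injective fun t : ZMod n => (π ^ t.val) x := by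
    intro s t h
    have := (ZMod.natCast_eq_natCast_iff _ _ _).2 (hpow.1 h)
    simpa using this
  have hbij : Function.Bijective fun t : ZMod n => (π ^ t.val) x :=
    (Fintype.bijective_iff_injective_and_card _).2 ⟨hinj, by simp⟩
  refine ⟨Equiv.ofBijective _ hbij, ?_, by simp⟩
  ext y : 1
  obtain ⟨t, rfl⟩ := (Equiv.ofBijective _ hbij).surjective y
  rw [cyclePerm_apply]
  simp only [Equiv.ofBijective_apply]
  rw [← Equiv.Perm.mul_apply, ← pow_succ', hpow, ← ZMod.natCast_eq_natCast_iff]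
  simp

theorem eq_of_cyclePerm_eq {n : ℕ} [NeZero n] {φ ψ : ZMod n ≃ Fin n}
    (h : cyclePerm φ = cyclePerm ψ) (h0 : φ 0 = ψ 0) : φ = ψ := by
  ext t : 1
  have h1 := cyclePerm_pow_apply φ t.val 0
  have h2 := cyclePerm_pow_apply ψ t.val 0
  rw [h, h0, h2] at h1
  simpa using h1.symm

-- The factor `n` is the choice of the starting point `φ 0`.
open Finset Classical in
theorem card_cyclic_listings {n : ℕ} [NeZero n] (P : Equiv.Perm (Fin n) → Prop) :
    #{φ : ZMod n ≃ Fin n | P (cyclePerm φ)} =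
      #{π : Equiv.Perm (Fin n) | IsNCycle π ∧ P π} * n := by
  have hprod : #((univ.filter fun π : Equiv.Perm (Fin n) => IsNCycle π ∧ P π) ×ˢ
      (univ : Finset (Fin n))) =
      #{π : Equiv.Perm (Fin n) | IsNCycle π ∧ P π} * n := by
    rw [Finset.card_product, Finset.card_univ, Fintype.card_fin]
  rw [← hprod]
  refine Finset.card_bij (fun φ _ => (cyclePerm φ, φ 0)) ?_ ?_ ?_
  · intro φ hφ
    simpa [isNCycle_cyclePerm] using hφ
  · intro φ _ ψ _ h
    rw [Prod.mk.injEq] at h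
    exact eq_of_cyclePerm_eq h.1 h.2
  · rintro ⟨π, x⟩ hπ
    simp only [mem_product, mem_filter, mem_univ, true_and, and_true] at hπ
    obtain ⟨φ, rfl, rfl⟩ := hπ.1.exists_cyclePerm_eq x
    exact ⟨φ, by simpa using hπ.2, rfl⟩

/-- If the rotation along `φ` increases on the fibers of a monotone `c`, then `φ` lists `Fin n`
in the lexicographic order of the words read off `c ∘ φ`. -/
theorem readFrom_lt_of_lt {n : ℕ} [NeZero n] {ι : Type*} [LinearOrder ι] {c : Fin n → ι}
    (hc : Monotone c) {φ : ZMod n ≃ Fin n} (hφ : StrictMonoOnFibers c (cyclePerm φ))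
    {s t : ZMod n} (hst : φ s < φ t) : readFrom (c ∘ φ) s < readFrom (c ∘ φ) t := by
  -- Each rotation step preserves the order as long as the letters agree.
  have hstep : ∀ k : ℕ, (∀ j < k, c (φ (s + j)) = c (φ (t + j))) → φ (s + k) < φ (t + k) := by
    intro k
    induction k with
    | zero => simpa using hst
    | succ k ih =>
      intro hk
      have := hφ (ih fun j hj => hk j (by omega)) (hk k (by omega))
      rwa [cyclePerm_apply, cyclePerm_apply, add_assoc, add_assoc, ← Nat.cast_succ] at this
  -- Otherwise translation by `t - s` would raise `φ` at every point, although it only permutes the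
  -- summands of `∑ u, φ u`.
  have hex : ∃ k : ℕ, c (φ (s + k)) ≠ c (φ (t + k)) := by
    by_contra! h
    have hlt : ∀ u, (φ u : ℕ) < φ (u + (t - s)) := by
      intro u
      have := hstep (u - s).val fun j _ => h j
      rw [ZMod.natCast_zmod_val] at this
      rw [add_sub_cancel, show t + (u - s) = u + (t - s) by ring] at this
      exact this
    have hsum : ∑ u, (φ u : ℕ) < ∑ u, (φ (u + (t - s)) : ℕ) :=
      Finset.sum_lt_sum_of_nonempty Finset.univ_nonempty fun u _ => hlt u
    exact hsum.ne' (Equiv.sum_comp (Equiv.addRight (t - s)) fun u => (φ u : ℕ))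
  classical
  refine ⟨Nat.find hex, fun j hj => not_not.1 (Nat.find_min hex hj), ?_⟩
  refine lt_of_le_of_ne (hc (hstep _ fun j hj => not_not.1 (Nat.find_min hex hj)).le) ?_
  exact Nat.find_spec hex

theorem readFrom_comp_injective {n : ℕ} [NeZero n] {ι : Type*} [LinearOrder ι] {c : Fin n → ι}
    (hc : Monotone c) {φ : ZMod n ≃ Fin n} (hφ : StrictMonoOnFibers c (cyclePerm φ)) :
    Function.Injective (readFrom (c ∘ φ)) := by
  intro s t h
  by_contra hne
  rcases lt_or_gt_of_ne (φ.injective.ne hne) with h' | h'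
  · exact (readFrom_lt_of_lt hc hφ h').ne h
  · exact (readFrom_lt_of_lt hc hφ h').ne h.symm

theorem isPrimitiveWord_comp {n : ℕ} [NeZero n] {ι : Type*} [LinearOrder ι] {c : Fin n → ι}
    (hc : Monotone c) {φ : ZMod n ≃ Fin n} (hφ : StrictMonoOnFibers c (cyclePerm φ)) :
    IsPrimitiveWord (c ∘ φ) := by
  intro t ht
  refine readFrom_comp_injective hc hφ ?_
  funext k
  simp only [readFrom_apply]
  rw [zero_add, add_comm, ht]

/-- Each inverse listing enumerates the words read off in increasing order, and a strictly monotone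
map on `Fin n` is determined by its range. -/
theorem eq_of_comp_eq {n : ℕ} [NeZero n] {ι : Type*} [LinearOrder ι] {c : Fin n → ι}
    (hc : Monotone c) {φ ψ : ZMod n ≃ Fin n} (hφ : StrictMonoOnFibers c (cyclePerm φ))
    (hψ : StrictMonoOnFibers c (cyclePerm ψ)) (h : c ∘ φ = c ∘ ψ) : φ = ψ := by
  have mono : ∀ {χ : ZMod n ≃ Fin n}, StrictMonoOnFibers c (cyclePerm χ) →
      StrictMono (readFrom (c ∘ χ) ∘ χ.symm) := fun hχ i j hij =>
    readFrom_lt_of_lt hc hχ (by simpa using hij)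
  have hr := (StrictMono.range_inj (mono hφ) (mono hψ)).1 (by
    rw [φ.symm.surjective.range_comp, ψ.symm.surjective.range_comp, h])
  rw [← h] at hr
  have : φ.symm = ψ.symm := by
    ext i : 1
    exact readFrom_comp_injective hc hφ (congrFun hr i)
  simpa using congrArg Equiv.symm this

theorem readFrom_le_head {n : ℕ} {ι : Type*} [LinearOrder ι] {w : ZMod n → ι} {s t : ZMod n}
    (h : readFrom w s ≤ readFrom w t) : w s ≤ w t := by
  rcases h.eq_or_lt with h | ⟨k, hk, hlt⟩
  · simpa [readFrom_apply] using (congrFun h 0).le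
  · rcases Nat.eq_zero_or_pos k with rfl | hpos
    · simpa [readFrom_apply] using hlt.le
    · simpa [readFrom_apply] using (hk 0 hpos).le

theorem readFrom_succ_lt {n : ℕ} {ι : Type*} [LinearOrder ι] {w : ZMod n → ι} {s t : ZMod n}
    (h : readFrom w s < readFrom w t) (hw : w s = w t) :
    readFrom w (s + 1) < readFrom w (t + 1) := by
  obtain ⟨k, hk, hlt⟩ := h
  cases k with
  | zero =>
    simp only [readFrom_apply, Nat.cast_zero, add_zero] at hlt
    exact absurd hw hlt.ne
  | succ k =>
    refine ⟨k, fun j hj => ?_, ?_⟩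
    · have := hk (j + 1) (by omega)
      simpa [readFrom_apply, add_assoc, add_comm, add_left_comm] using this
    · simpa [readFrom_apply, add_assoc, add_comm, add_left_comm] using hlt

open Finset in
/-- Every primitive word with the letter multiplicities of `c` comes from sorting its rotations. -/
theorem IsPrimitiveWord.exists_comp_eq {n : ℕ} [NeZero n] {ι : Type*} [LinearOrder ι]
    {c : Fin n → ι} (hc : Monotone c) {w : ZMod n → ι} (hw : IsPrimitiveWord w)
    (hcard : ∀ i, #{t | w t = i} = #{x | c x = i}) :
    ∃ φ : ZMod n ≃ Fin n, StrictMonoOnFibers c (cyclePerm φ) ∧ c ∘ φ = w := by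
  obtain ⟨e, he⟩ : ∃ e : ZMod n ≃ Fin n, ∀ s t, e s ≤ e t ↔ readFrom w s ≤ readFrom w t := by
    let _ : LinearOrder (ZMod n) := LinearOrder.lift' (readFrom w) hw.readFrom_injective
    let e := (Fintype.orderIsoFinOfCardEq (ZMod n) (ZMod.card n)).symm
    exact ⟨e.toEquiv, fun s t => e.le_iff_le⟩
  -- Both `c` and `w ∘ e.symm` are monotone rearrangements of the same letters, hence equal.
  have hcomp : c ∘ e = w := by
    obtain ⟨g, hg⟩ := exists_perm_comp_eq_of_card_fiber_eq hcard
    have hm : Monotone (c ∘ (e.symm.trans g : Equiv.Perm (Fin n))) := by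
      intro i j hij
      have h1 : ∀ x, c ((e.symm.trans g) x) = w (e.symm x) := fun x => congrFun hg _
      simp only [Function.comp_apply, h1]
      exact readFrom_le_head ((he _ _).1 (by simpa using hij))
    have := Tuple.unique_monotone (f := c) (σ := 1) (τ := e.symm.trans g) (by simpa using hc) hm
    rw [← hg]
    ext t
    simpa using congrFun this (e t)
  refine ⟨e, ?_, hcomp⟩
  intro x y hxy hcxy
  obtain ⟨s, rfl⟩ := e.surjective x
  obtain ⟨t, rfl⟩ := e.surjective y
  have he' : ∀ s t, e s < e t ↔ readFrom w s < readFrom w t := fun s t =>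
    lt_iff_lt_of_le_iff_le (he t s)
  rw [cyclePerm_apply, cyclePerm_apply, he']
  refine readFrom_succ_lt ((he' _ _).1 hxy) ?_
  rw [← hcomp]
  exact hcxy

open Finset Classical in
theorem card_nCycles_strictMonoOnFibers_mul {n : ℕ} [NeZero n] {ι : Type*} [LinearOrder ι]
    [Fintype ι] {c : Fin n → ι} (hc : Monotone c) :
    #{π : Equiv.Perm (Fin n) | IsNCycle π ∧ StrictMonoOnFibers c π} * n =
      #{w : ZMod n → ι | (∀ i, #{t | w t = i} = #{x | c x = i}) ∧ IsPrimitiveWord w} := by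
  rw [← card_cyclic_listings]
  refine Finset.card_bij (fun φ _ => c ∘ φ) ?_ ?_ ?_
  · intro φ hφ
    simp only [mem_filter, mem_univ, true_and] at hφ ⊢
    exact ⟨fun i => Finset.card_equiv φ (by simp), isPrimitiveWord_comp hc hφ⟩
  · intro φ hφ ψ hψ h
    simp only [mem_filter, mem_univ, true_and] at hφ hψ
    exact eq_of_comp_eq hc hφ hψ h
  · intro w hw
    simp only [mem_filter, mem_univ, true_and] at hw
    obtain ⟨φ, hφ, h⟩ := hw.2.exists_comp_eq hc hw.1
    exact ⟨φ, by simpa using hφ, h⟩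

/-! ### Blocks and descents -/

open Finset in
theorem orderEmbOfFin_le_iff_lt_card_filter (K : Finset ℕ) (i : Fin #K) (x : ℕ) :
    K.orderEmbOfFin rfl i ≤ x ↔ (i : ℕ) < #{k ∈ K | k ≤ x} := by
  have hcard : #{k ∈ K | k ≤ x} = #{j : Fin #K | K.orderEmbOfFin rfl j ≤ x} := by
    conv_lhs => rw [← K.map_orderEmbOfFin_univ rfl, Finset.filter_map, Finset.card_map]
    rfl
  rw [hcard]
  constructor
  · intro h
    rw [← Nat.succ_le_iff, Nat.succ_eq_add_one, ← Fin.card_Iic i]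
    refine Finset.card_le_card fun j hj => ?_
    simp only [mem_filter, mem_univ, true_and, mem_Iic] at hj ⊢
    exact ((K.orderEmbOfFin rfl).monotone hj).trans h
  · contrapose!
    intro h
    rw [← Fin.card_Iio i]
    refine Finset.card_le_card fun j hj => ?_
    simp only [mem_filter, mem_univ, true_and, mem_Iio] at hj ⊢
    exact (K.orderEmbOfFin rfl).lt_iff_lt.1 (hj.trans_lt h)

open Finset in
theorem card_filter_le_lt_card {n : ℕ} {K : Finset ℕ} (hn : n ∈ K) (x : Fin n) :
    #{k ∈ K | k ≤ (x : ℕ)} < #K :=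
  Finset.card_lt_card (Finset.filter_ssubset.2 ⟨n, hn, by simp⟩)

open Finset in
/-- The index of the block of `{1, …, n}` cut out by `K` in which the position `x + 1` lies. -/
def blockIndex {n : ℕ} {K : Finset ℕ} (hn : n ∈ K) (x : Fin n) : Fin #K :=
  ⟨#{k ∈ K | k ≤ (x : ℕ)}, card_filter_le_lt_card hn x⟩

theorem monotone_blockIndex {n : ℕ} {K : Finset ℕ} (hn : n ∈ K) :
    Monotone (blockIndex hn) := by
  intro x y hxy
  refine Finset.card_le_card (Finset.monotone_filter_right _ fun k _ hk => ?_)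
  exact hk.trans hxy

open Finset in
/-- The parts of `C(K)` are the block sizes. -/
theorem compositionOf_eq_ofFn {n : ℕ} {K : Finset ℕ} (hK : K ⊆ Finset.Icc 1 n) (hn : n ∈ K) :
    compositionOf K = List.ofFn fun i : Fin #K => #{x | blockIndex hn x = i} := by
  refine List.ext_getElem (by simp [compositionOf]) fun i h₁ h₂ => ?_
  have hi : i < #K := by simpa using h₂
  have hlast : K.orderEmbOfFin rfl ⟨i, hi⟩ ≤ n :=
    (mem_Icc.1 (hK (K.orderEmbOfFin_mem rfl ⟨i, hi⟩))).2
  simp only [compositionOf, List.getElem_zipWith, List.getElem_ofFn]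
  -- In 0-based positions a block is a half-open interval between consecutive cuts; the prepended
  -- `0` is the left end of the first.
  have hmem : ∀ x : Fin n, blockIndex hn x = ⟨i, hi⟩ ↔
      (0 :: K.sort (· ≤ ·))[i]'(by simp; omega) ≤ (x : ℕ) ∧
        (x : ℕ) < K.orderEmbOfFin rfl ⟨i, hi⟩ := by
    intro x
    have hlt := (orderEmbOfFin_le_iff_lt_card_filter K ⟨i, hi⟩ x).not
    rw [not_le] at hlt
    rw [hlt, blockIndex, Fin.mk.injEq]
    cases i with
    | zero => simp
    | succ i =>
      have := orderEmbOfFin_le_iff_lt_card_filter K ⟨i, by omega⟩ x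
      rw [orderEmbOfFin_apply] at this
      simp only [List.getElem_cons_succ]
      simp only [Fin.getElem_fin] at this
      rw [this]
      omega
  simp only [hmem]
  rw [← Finset.card_map Fin.valEmbedding, ← Nat.card_Ico]
  congr 1
  ext k
  simp only [mem_Ico, mem_map, mem_filter, mem_univ, true_and, Fin.valEmbedding_apply]
  constructor
  · rintro h
    exact ⟨⟨k, lt_of_lt_of_le h.2 hlast⟩, h, rfl⟩
  · rintro ⟨x, h, rfl⟩
    exact h

theorem mem_descentSet_self {n : ℕ} (hn : 1 ≤ n) (π : Equiv.Perm (Fin n)) :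
    n ∈ descentSet π := by
  simp [descentSet, hn]

/-- The descents of `π` lie in `K` if and only if `π` increases on the blocks of `K`. -/
theorem descentSet_subset_iff {n : ℕ} {K : Finset ℕ} (hn : n ∈ K) (π : Equiv.Perm (Fin n)) :
    descentSet π ⊆ K ↔ StrictMonoOnFibers (blockIndex hn) π := by
  constructor
  · intro h x y hxy hc
    -- A cut in `(x, y]` would make the block index of `y` larger than that of `x`.
    have hgap : ∀ k ∈ K, (x : ℕ) < k → (y : ℕ) < k := by
      intro k hk hxk
      by_contra! hky
      refine absurd (congrArg Fin.val hc) (ne_of_lt ?_)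
      refine Finset.card_lt_card (Finset.ssubset_iff_of_subset ?_ |>.2 ⟨k, ?_, ?_⟩)
      · exact Finset.monotone_filter_right _ fun l _ hl => hl.trans hxy.le
      · simp [hk, hky]
      · simp [hxk]
    have key : ∀ m : ℕ, ∀ hm : (x : ℕ) + 1 + m < n, (x : ℕ) + 1 + m ≤ y →
        π x < π ⟨x + 1 + m, hm⟩ := by
      have hstep : ∀ (i : ℕ) (hi : i + 1 < n), (x : ℕ) ≤ i → i + 1 ≤ y →
          π ⟨i, by omega⟩ < π ⟨i + 1, hi⟩ := by
        intro i hi hxi hiy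
        by_contra hlt
        have hne : π ⟨i + 1, hi⟩ ≠ π ⟨i, by omega⟩ := fun he => by
          simpa using congrArg Fin.val (π.injective he)
        have hmem : i + 1 ∈ descentSet π := by
          simp only [descentSet, Finset.mem_filter, Finset.mem_Icc]
          exact ⟨by omega, Or.inr ⟨⟨i, by omega⟩, ⟨i + 1, hi⟩, rfl, rfl,
            lt_of_le_of_ne (not_lt.1 hlt) hne⟩⟩
        have := hgap _ (h hmem) (by omega)
        omega
      intro m
      induction m with
      | zero => exact fun hm hy => hstep x hm le_rfl hy
      | succ m ih =>
        intro hm hy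
        exact (ih (by omega) (by omega)).trans (hstep (x + 1 + m) hm (by omega) hy)
    have hlt : (x : ℕ) < y := hxy
    have hy : (x : ℕ) + 1 + (y - (x + 1)) = y := by omega
    have := key (y - (x + 1)) (by omega) hy.le
    convert this using 2
    exact Fin.ext hy.symm
  · intro h k hk
    simp only [descentSet, Finset.mem_filter, Finset.mem_Icc] at hk
    rcases hk.2 with rfl | ⟨i, j, hi, hj, hlt⟩
    · exact hn
    · by_contra hkK
      have hij : i < j := Fin.lt_def.2 (by omega)
      refine lt_asymm hlt (h hij (Fin.ext ?_))
      refine congrArg Finset.card (Finset.filter_congr fun l hl => ?_)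
      have : l ≠ k := by rintro rfl; exact hkK hl
      omega

open Finset Classical in
/-- The number of `n`-cycles whose descents lie in `K` is `M(C(K))`. -/
theorem card_nCycles_descentSet_subset {n : ℕ} {K : Finset ℕ} (hK : K ⊆ Finset.Icc 1 n)
    (hn : n ∈ K) :
    (#{π : Equiv.Perm (Fin n) | IsNCycle π ∧ descentSet π ⊆ K} : ℚ) =
      necklaceM (compositionOf K) := by
  have hn0 : n ≠ 0 := by have := (mem_Icc.1 (hK hn)).1; omega
  have : NeZero n := ⟨hn0⟩
  have hsum : ∑ i, #{x | blockIndex hn x = i} = n := by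
    rw [← Finset.card_eq_sum_card_fiberwise (f := blockIndex hn) (by simp [Set.MapsTo]),
      Finset.card_univ, Fintype.card_fin]
  have h := card_nCycles_strictMonoOnFibers_mul (monotone_blockIndex hn)
  have hprim := card_primitive_words (fun i => #{x | blockIndex hn x = i}) hsum
  simp only [descentSet_subset_iff hn]
  rw [necklaceM, compositionOf_eq_ofFn hK hn]
  simp only [List.sum_ofFn, hsum, List.map_ofFn, List.prod_ofFn, List.forall_mem_ofFn_iff,
    Function.comp_apply, Nat.cast_prod]
  have hq := congrArg (Nat.cast (R := ℚ)) h
  rw [Nat.cast_mul] at hq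
  rw [one_div, eq_inv_mul_iff_mul_eq₀ (Nat.cast_ne_zero.2 hn0), mul_comm]
  refine hq.trans ?_
  convert hprim

/-! ### Inclusion-exclusion -/

theorem sum_neg_one_pow_card_sub_of_subset {α : Type*} [DecidableEq α] {D J : Finset α} :
    ∑ K ∈ J.powerset with D ⊆ K, (-1 : ℚ) ^ (J.card - K.card) = if D = J then 1 else 0 := by
  by_cases hDJ : D ⊆ J
  · have h := Finset.sum_powerset_neg_one_pow_card (x := J \ D)
    have hsum : ∑ K ∈ J.powerset with D ⊆ K, (-1 : ℚ) ^ (J.card - K.card) =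
        ∑ m ∈ (J \ D).powerset, (-1 : ℚ) ^ m.card := by
      -- Complementation in `J` reduces to the alternating sum over all subsets of `J \ D`.
      refine Finset.sum_nbij' (fun K => J \ K) (fun m => J \ m) ?_ ?_ ?_ ?_ ?_
      · intro K hK
        simp only [Finset.mem_filter, Finset.mem_powerset] at hK ⊢
        exact Finset.sdiff_subset_sdiff subset_rfl hK.2
      · intro m hm
        simp only [Finset.mem_filter, Finset.mem_powerset] at hm ⊢
        refine ⟨Finset.sdiff_subset, fun x hx => ?_⟩
        exact Finset.mem_sdiff.2 ⟨hDJ hx, fun hxm => (Finset.mem_sdiff.1 (hm hxm)).2 hx⟩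
      · intro K hK
        exact Finset.sdiff_sdiff_eq_self (Finset.mem_powerset.1 (Finset.mem_filter.1 hK).1)
      · intro m hm
        exact Finset.sdiff_sdiff_eq_self ((Finset.mem_powerset.1 hm).trans Finset.sdiff_subset)
      · intro K hK
        rw [Finset.card_sdiff_of_subset (Finset.mem_powerset.1 (Finset.mem_filter.1 hK).1)]
    rw [hsum]
    have hcond : J \ D = ∅ ↔ D = J := by
      rw [Finset.sdiff_eq_empty_iff_subset]
      exact ⟨fun h => hDJ.antisymm h, fun h => h.symm.subset⟩
    simp only [hcond] at h
    exact_mod_cast h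
  · rw [if_neg (fun h => hDJ h.subset), Finset.filter_eq_empty_iff.2, Finset.sum_empty]
    intro K hK hDK
    exact hDJ (hDK.trans (Finset.mem_powerset.1 hK))

theorem corollary7 (n : ℕ) (J : Finset ℕ) (hJ : J ⊆ Finset.Icc 1 n) (hn : n ∈ J) :
    (({π : Equiv.Perm (Fin n) | IsNCycle π ∧ descentSet π = J}.ncard : ℕ) : ℚ) =
      ∑ K ∈ J.powerset with n ∈ K, (-1 : ℚ) ^ (J.card - K.card) * necklaceM (compositionOf K) := by
  classical
  have hn1 : 1 ≤ n := (Finset.mem_Icc.1 (hJ hn)).1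
  have hM : ∀ K ∈ J.powerset.filter (n ∈ ·),
      (-1 : ℚ) ^ (J.card - K.card) * necklaceM (compositionOf K) =
        ∑ π : Equiv.Perm (Fin n) with IsNCycle π,
          if descentSet π ⊆ K then (-1 : ℚ) ^ (J.card - K.card) else 0 := by
    intro K hK
    simp only [Finset.mem_filter, Finset.mem_powerset] at hK
    rw [← card_nCycles_descentSet_subset (hK.1.trans hJ) hK.2, ← Finset.sum_filter,
      Finset.filter_filter, Finset.sum_const, nsmul_eq_mul, mul_comm]
  rw [Finset.sum_congr rfl hM, Finset.sum_comm]
  have hinner : ∀ π : Equiv.Perm (Fin n),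
      (∑ K ∈ J.powerset with n ∈ K,
        if descentSet π ⊆ K then (-1 : ℚ) ^ (J.card - K.card) else 0) =
        if descentSet π = J then 1 else 0 := by
    intro π
    rw [← sum_neg_one_pow_card_sub_of_subset, ← Finset.sum_filter, Finset.filter_filter]
    refine Finset.sum_congr (Finset.filter_congr fun K _ => ?_) fun _ _ => rfl
    -- The condition `n ∈ K` is automatic, as `n` is always a descent.
    exact ⟨fun h => h.2, fun h => ⟨h (mem_descentSet_self hn1 π), h⟩⟩
  simp only [hinner]
  rw [← Finset.natCast_card_filter, Finset.filter_filter, ← Set.ncard_coe_finset]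
  simp
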